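/- **Theorem (Lower bound on the outage probability).** Let $N_t,N_r\ge 1$ be integers, $t=\min(N_t,N_r)$ and $g=N_r$. Let $H_w$ be an $N_r\times N_t$ random matrix whose entries are independent circularly symmetric complex Gaussian variables with mean $0$ and variance $1$, let $R_t$ be an $N_t\times N_t$ positive-definite Hermitian matrix, let $R_t^{1/2}$ be a square root of it, i.e. $R_t^{1/2}(R_t^{1/2})^H=R_t$, and let $H=H_wR_t^{1/2}$ (a Rayleigh MIMO channel with transmit correlation). Let $D_1,\dots,D_{N_t}>0$ be the singular values of $R_t^{1/2}$, with multiplicity, listed in any fixed order (for instance descending). For an SNR $\eta>0$ and a multiplexing gain $r$ put $$I=\log_2\det\Bigl(I_{N_r}+\frac{\eta}{N_t}HH^H\Bigr),\qquad P_{out}=\mathrm{Prob}\bigl(I<r\log_2(1+g\eta)\bigr).$$ Let $b_1,\dots,b_t$ be arbitrary positive numbers with $\sum_{l=1}^t b_l=r$, and let $$\xi_l=\frac{N_t}{\eta}\bigl((1+g\eta)^{b_l}-1\bigr),\qquad \Gamma_{inc}(x,a)=\frac1{(a-1)!}\int_0^x u^{a-1}e^{-u}\,du .$$ 1. (Uncorrelated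 case.) If $D_k^2=1$ for all $k=1,\dots,N_t$, then $$P_{out}\ \ge\ \prod_{l=1}^t\Gamma_{inc}(\xi_l,\,N_r+N_t-2l+1).$$ 2. (Correlated case.) If $D_1^2,\dots,D_{N_t}^2$ are pairwise distinct, then $$P_{out}\ \ge\ \prod_{l=1}^t\Bigl(\sum_{k=1}^{N_r-l+1}a_k^{(l)}\,\Gamma_{inc}\Bigl(\frac{\xi_l}{D_l^2},k\Bigr)+\sum_{k=1}^{N_t-l}a_1^{(l+k)}\,\Gamma_{inc}\Bigl(\frac{\xi_l}{D_{l+k}^2},1\Bigr)\Bigr),$$ where, for each $l$, with the rational function $$\Psi_l(s)=(1-sD_l^2)^{-(N_r-l+1)}\prod_{k=1}^{N_t-l}(1-sD_{l+k}^2)^{-1},$$ the coefficients in the $l$-th factor are (the removable singularities being removed) $$a_k^{(l)}=\frac{(-D_l^2)^{-(N_r-l+1-k)}}{(N_r-l+1-k)!}\,\frac{d^{\,N_r-l+1-k}}{ds^{\,N_r-l+1-k}}\Bigl[(1-sD_l^2)^{N_r-l+1}\Psi_l(s)\Bigr]_{s=D_l^{-2}},\qquad a_1^{(l+k)}=\Bigl[(1-sD_{l+k}^2)\Psi_l(s)\Bigr]_{s=D_{l+k}^{-2}}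 .$$ -/

import Mathlib

open MeasureTheory ProbabilityTheory
open scoped Matrix Nat ComplexOrder

noncomputable section

namespace MimoOutage

/-- The standard circularly symmetric complex Gaussian law with mean zero and unit variance:
the real and imaginary parts are independent real Gaussians of variance `1 / 2`. -/
def complexGaussian : Measure ℂ :=
  ((gaussianReal 0 (1 / 2)).prod (gaussianReal 0 (1 / 2))).map
    Complex.measurableEquivRealProd.symm

/-- `Hw` is a spatially uncorrelated Rayleigh channel matrix under `P`: its entries are independent
standard circularly symmetric complex Gaussian random variables. -/
def IsRayleigh {Ω : Type*} [MeasurableSpace Ω] (P : Measure Ω) {Nr Nt : ℕ}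
    (Hw : Ω → Matrix (Fin Nr) (Fin Nt) ℂ) : Prop :=
  iIndepFun (fun (p : Fin Nr × Fin Nt) (ω : Ω) => Hw ω p.1 p.2) P ∧
    ∀ i j, HasLaw (fun ω => Hw ω i j) complexGaussian P

/-- `D` lists the singular values of the square matrix `S` (with multiplicity): there is a singular
value decomposition `S = U * diagonal D * Vᴴ` with unitary `U`, `V`. -/
def IsSingularValues {n : ℕ} (S : Matrix (Fin n) (Fin n) ℂ) (D : Fin n → ℝ) : Prop :=
  (∀ k, 0 ≤ D k) ∧
    ∃ U ∈ Matrix.unitaryGroup (Fin n) ℂ, ∃ V ∈ Matrix.unitaryGroup (Fin n) ℂ,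
      S = U * Matrix.diagonal (fun k => (D k : ℂ)) * Vᴴ

/-- Mutual information (bits/s/Hz) of the channel matrix `H` at SNR `η` with equal power
allocation, `log₂ det (I + (η / Nt) H Hᴴ)`. The determinant is a positive real number when
`0 ≤ η`, so taking its real part loses nothing. -/
def mutualInfo {Nr Nt : ℕ} (η : ℝ) (H : Matrix (Fin Nr) (Fin Nt) ℂ) : ℝ :=
  Real.logb 2 (1 + ((η / Nt : ℝ) : ℂ) • (H * Hᴴ)).det.re

/-- The array gain, equal to the number of receive antennas. -/
def arrayGain (Nr : ℕ) : ℝ := Nr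

/-- The spectral efficiency `R = r * log₂ (1 + g η)` at multiplexing gain `r` and SNR `η`. -/
def rate (Nr : ℕ) (r η : ℝ) : ℝ := r * Real.logb 2 (1 + arrayGain Nr * η)

/-- The outage probability `P(I < R)` of the random channel matrix `H`. -/
def outageProb {Ω : Type*} [MeasurableSpace Ω] (P : Measure Ω) {Nr Nt : ℕ}
    (H : Ω → Matrix (Fin Nr) (Fin Nt) ℂ) (r η : ℝ) : ℝ :=
  P.real {ω | mutualInfo η (H ω) < rate Nr r η}

/-- The regularized incomplete Gamma function `(1 / (a - 1)!) * ∫₀ˣ t^(a-1) e^(-t) dt`, for integers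
`1 ≤ a`. -/
def gammaInc (x : ℝ) (a : ℕ) : ℝ :=
  1 / ((a - 1)! : ℝ) * ∫ t in (0 : ℝ)..x, t ^ (a - 1) * Real.exp (-t)

/-- `ξ = (Nt / η) * ((1 + g η) ^ b - 1)`. -/
def xi (Nr Nt : ℕ) (η b : ℝ) : ℝ :=
  Nt / η * ((1 + arrayGain Nr * η) ^ b - 1)

/-- The rational function `Ψ(s) = (1 - s D_l²)^{-(Nr - l + 1)} ∏_{j > l} (1 - s D_j²)^{-1}`
(`l` counted from one), the moment generating function of `Δ_l`. The index `l : Fin Nt` counts from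
zero, so the exponent `Nr - l + 1` becomes `Nr - l` here and below. -/
def mgfDelta (Nr : ℕ) {Nt : ℕ} (D : Fin Nt → ℝ) (l : Fin Nt) (s : ℝ) : ℝ :=
  ((1 - s * D l ^ 2) ^ (Nr - (l : ℕ)))⁻¹ * ∏ j ∈ Finset.Ioi l, (1 - s * D j ^ 2)⁻¹

/-- The function `s ↦ (1 - s D_l²)^{Nr - l + 1} Ψ(s)` with the pole at `s = D_l⁻²` cancelled. -/
def headFun {Nt : ℕ} (D : Fin Nt → ℝ) (l : Fin Nt) (s : ℝ) : ℝ :=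
  ∏ j ∈ Finset.Ioi l, (1 - s * D j ^ 2)⁻¹

/-- The function `s ↦ (1 - s D_j²) Ψ(s)`, `l < j`, with the pole at `s = D_j⁻²` cancelled. -/
def tailFun (Nr : ℕ) {Nt : ℕ} (D : Fin Nt → ℝ) (l j : Fin Nt) (s : ℝ) : ℝ :=
  ((1 - s * D l ^ 2) ^ (Nr - (l : ℕ)))⁻¹ * ∏ i ∈ (Finset.Ioi l).erase j, (1 - s * D i ^ 2)⁻¹

/-- Away from the pole, `headFun` is the product of `Ψ` with the cancelling factor. -/
theorem headFun_eq (Nr : ℕ) {Nt : ℕ} (D : Fin Nt → ℝ) (l : Fin Nt) (s : ℝ)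
    (hs : 1 - s * D l ^ 2 ≠ 0) :
    (1 - s * D l ^ 2) ^ (Nr - (l : ℕ)) * mgfDelta Nr D l s = headFun D l s := by
  unfold mgfDelta headFun
  rw [← mul_assoc, mul_inv_cancel₀ (pow_ne_zero _ hs), one_mul]

/-- Away from the pole, `tailFun` is the product of `Ψ` with the cancelling factor. -/
theorem tailFun_eq (Nr : ℕ) {Nt : ℕ} (D : Fin Nt → ℝ) (l j : Fin Nt) (hlj : l < j) (s : ℝ)
    (hs : 1 - s * D j ^ 2 ≠ 0) :
    (1 - s * D j ^ 2) * mgfDelta Nr D l s = tailFun Nr D l j s := by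
  unfold mgfDelta tailFun
  rw [← Finset.mul_prod_erase _ _ (Finset.mem_Ioi.mpr hlj)]
  field_simp

/-- The coefficient `a_k^{(l)}`, `1 ≤ k ≤ Nr - l + 1` (`l` counted from one):
`(-D_l²)^{-m} / m! * (d/ds)^m [(1 - s D_l²)^{Nr - l + 1} Ψ(s)]` at `s = D_l⁻²`, where
`m = Nr - l + 1 - k`. -/
def headCoeff (Nr : ℕ) {Nt : ℕ} (D : Fin Nt → ℝ) (l : Fin Nt) (k : ℕ) : ℝ :=
  ((-(D l ^ 2)) ^ (Nr - (l : ℕ) - k))⁻¹ / ((Nr - (l : ℕ) - k)! : ℝ) *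
    iteratedDeriv (Nr - (l : ℕ) - k) (headFun D l) ((D l ^ 2)⁻¹)

/-- The coefficient `a_1^{(j)}` for `l < j`: the value of `(1 - s D_j²) Ψ(s)` at `s = D_j⁻²`. -/
def tailCoeff (Nr : ℕ) {Nt : ℕ} (D : Fin Nt → ℝ) (l j : Fin Nt) : ℝ :=
  tailFun Nr D l j ((D j ^ 2)⁻¹)

/-- The `l`-th factor of the correlated bound:
`∑_{k=1}^{Nr-l+1} a_k^{(l)} Γ_inc(x / D_l², k) + ∑_{j>l} a_1^{(j)} Γ_inc(x / D_j², 1)`. -/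
def corrFactor (Nr : ℕ) {Nt : ℕ} (D : Fin Nt → ℝ) (l : Fin Nt) (x : ℝ) : ℝ :=
  ∑ k ∈ Finset.Icc 1 (Nr - (l : ℕ)), headCoeff Nr D l k * gammaInc (x / D l ^ 2) k +
    ∑ j ∈ Finset.Ioi l, tailCoeff Nr D l j * gammaInc (x / D j ^ 2) 1

end MimoOutage

end

/-!
Write `S = U D Vᴴ`. Since `V` cancels in `H Hᴴ` and the law of the uncorrelated channel is
invariant under right multiplication by the unitary `U`, the outage event concerns
`det (I + c ∑ⱼ Dⱼ² hⱼ hⱼᴴ)` for independent complex Gaussian columns `hⱼ` and `c = η / Nt`.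

This determinant is bounded by triangularizing the columns one at a time. Conditionally on `h₀`, a
unitary matrix moves `h₀` to the first coordinate axis; it changes neither the determinant nor the
law of the other columns (`measurePreserving_unitary_mulVec`). Fischer's inequality
(`det_le_mul_det_submatrix_succ`) bounds the determinant by the first diagonal entry `1 + c Δ₀`
times the determinant of the remaining block, where `Δ₀ = D₀² ‖h₀‖² + ∑_{j > 0} Dⱼ² |zⱼ|²` and the
`zⱼ` are the first coordinates of the transformed columns. These are independent of the remaining
block, which has the same form with one row and one column less. Hence (`rowProb_mul_le`,
`prod_rowProb_le_lt`) the probability that the determinant stays below `∏ (1 + c ξ_l)` is at least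
`∏ P(Δ_l < ξ_l)`, and `1 + c ξ_l = (1 + g η) ^ b_l` turns the threshold into `(1 + g η) ^ r`.

The variable `Δ_l` is a weighted sum of independent exponential variables, so its characteristic
function is the rational function `Ψ_l` at an imaginary argument (`charFun_rowLaw`). With equal
weights this is a Gamma law. With distinct weights, the partial fractions of `Ψ_l`
(`charFun_partialFractions`) write it as a signed combination of characteristic functions of Gamma
laws, and uniqueness of characteristic functions transfers this identity to the distribution
functions (`measureReal_eq_sum_of_charFun`).
-/

namespace MimoOutage

/-! ### The complex Gaussian law -/

instance : IsProbabilityMeasure complexGaussian :=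
  Measure.isProbabilityMeasure_map Complex.measurableEquivRealProd.symm.measurable.aemeasurable

theorem integral_complexGaussian {E : Type*} [NormedAddCommGroup E] [NormedSpace ℝ E]
    (f : ℂ → E) :
    ∫ z, f z ∂complexGaussian =
      ∫ p : ℝ × ℝ, f ⟨p.1, p.2⟩ ∂((gaussianReal 0 (1 / 2)).prod (gaussianReal 0 (1 / 2))) := by
  rw [complexGaussian, integral_map_equiv]
  rfl

/-- Since the exponent is a multiple of `‖t‖ ^ 2`, the characteristic function of a vector of
independent copies depends on the Euclidean norm only. -/
theorem charFun_complexGaussian (t : ℂ) :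
    charFun complexGaussian t = Complex.exp (-(‖t‖ ^ 2 / 4 : ℝ)) := by
  have h : ∀ p : ℝ × ℝ, Complex.exp ((inner ℝ (⟨p.1, p.2⟩ : ℂ) t : ℝ) * Complex.I) =
      Complex.exp (t.re * p.1 * Complex.I) * Complex.exp (t.im * p.2 * Complex.I) := by
    intro p
    rw [← Complex.exp_add]
    congr 1
    simp [Complex.inner, Complex.mul_re]
    ring
  rw [charFun_apply, integral_complexGaussian]
  simp_rw [h]
  rw [integral_prod_mul (fun x : ℝ => Complex.exp (t.re * x * Complex.I))
    (fun x : ℝ => Complex.exp (t.im * x * Complex.I)), ← charFun_apply_real, ← charFun_apply_real,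
    charFun_gaussianReal, charFun_gaussianReal, ← Complex.exp_add, ← Complex.normSq_eq_norm_sq,
    Complex.normSq_apply]
  congr 1
  push_cast
  ring

/-- The law of a vector of independent standard circularly symmetric complex Gaussian variables
is invariant under unitary transformations. -/
theorem measurePreserving_unitary_mulVec {ι : Type*} [Fintype ι] [DecidableEq ι]
    {U : Matrix ι ι ℂ} (hU : U ∈ Matrix.unitaryGroup ι ℂ) :
    MeasurePreserving (fun z : ι → ℂ => U *ᵥ z) (Measure.pi fun _ => complexGaussian)
      (Measure.pi fun _ => complexGaussian) := by
  have hm : Measurable (fun z : ι → ℂ => U *ᵥ z) :=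
    (Continuous.matrix_mulVec continuous_const continuous_id).measurable
  refine ⟨hm, ?_⟩
  have := Measure.isProbabilityMeasure_map (μ := Measure.pi fun _ : ι => complexGaussian)
    hm.aemeasurable
  refine charFun_eq_pi_iff.1 fun t => ?_
  have hprod : ∀ s : PiLp 2 (fun _ : ι => ℂ), ∏ i, charFun complexGaussian (s i) =
      Complex.exp (-((∑ i, ‖s i‖ ^ 2 : ℝ) / 4 : ℝ)) := by
    intro s
    simp_rw [charFun_complexGaussian, ← Complex.exp_sum]
    congr 1
    push_cast
    rw [Finset.sum_neg_distrib, Finset.sum_div]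
  set s : PiLp 2 (fun _ : ι => ℂ) := WithLp.toLp 2 (Uᴴ *ᵥ WithLp.ofLp t) with hs
  have hadj : ∀ (A : Matrix ι ι ℂ) (x y : ι → ℂ), star y ⬝ᵥ (A *ᵥ x) = star (Aᴴ *ᵥ y) ⬝ᵥ x := by
    intro A x y
    rw [Matrix.star_mulVec, Matrix.conjTranspose_conjTranspose, Matrix.dotProduct_mulVec]
  have hinner : ∀ x y : PiLp 2 (fun _ : ι => ℂ),
      inner ℝ x y = (star (WithLp.ofLp y) ⬝ᵥ WithLp.ofLp x).re := by
    intro x y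
    rw [PiLp.inner_apply, dotProduct, Complex.re_sum]
    refine Finset.sum_congr rfl fun i _ => ?_
    simp [Complex.inner, Complex.mul_re]
  have hnorm : ∑ i, ‖s i‖ ^ 2 = ∑ i, ‖t i‖ ^ 2 := by
    rw [← EuclideanSpace.norm_sq_eq, ← EuclideanSpace.norm_sq_eq, ← real_inner_self_eq_norm_sq,
      ← real_inner_self_eq_norm_sq, hinner, hinner, hs]
    change (star (Uᴴ *ᵥ WithLp.ofLp t) ⬝ᵥ (Uᴴ *ᵥ WithLp.ofLp t)).re = _
    rw [hadj, Matrix.conjTranspose_conjTranspose, Matrix.mulVec_mulVec,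
      show U * Uᴴ = 1 from (Matrix.mem_unitaryGroup_iff).1 hU, Matrix.one_mulVec]
  have hmap : ∀ (μ : Measure (ι → ℂ)) (u : PiLp 2 (fun _ : ι => ℂ)),
      charFun (μ.map (WithLp.toLp 2)) u =
        ∫ x, Complex.exp ((inner ℝ (WithLp.toLp 2 x) u : ℝ) * Complex.I) ∂μ := by
    intro μ u
    rw [charFun_apply, integral_map (by fun_prop) (by fun_prop)]
  rw [hprod, ← hnorm, ← hprod, ← charFun_pi, hmap, hmap,
    integral_map hm.aemeasurable (by fun_prop)]
  refine integral_congr_ae (.of_forall fun x => ?_)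
  simp only [hinner, hadj, hs]

/-- The squared modulus of a standard circularly symmetric complex Gaussian variable has the
characteristic function of the exponential law with unit mean. -/
theorem integral_exp_normSq_complexGaussian (t : ℝ) :
    ∫ z, Complex.exp ((t * ‖z‖ ^ 2 : ℝ) * Complex.I) ∂complexGaussian =
      (1 - t * Complex.I)⁻¹ := by
  have h : ∀ p : ℝ × ℝ, Complex.exp ((t * ‖(⟨p.1, p.2⟩ : ℂ)‖ ^ 2 : ℝ) * Complex.I) =
      Complex.exp (t * p.1 ^ 2 * Complex.I) * Complex.exp (t * p.2 ^ 2 * Complex.I) := by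
    intro p
    rw [← Complex.exp_add, ← Complex.normSq_eq_norm_sq, Complex.normSq_apply]
    congr 1
    push_cast
    ring
  -- The principal square root below gets squared, so its branch plays no role.
  have h1 : ∫ x : ℝ, Complex.exp (t * x ^ 2 * Complex.I) ∂(gaussianReal 0 (1 / 2)) =
      (Real.sqrt Real.pi : ℂ)⁻¹ * (Real.pi / (1 - t * Complex.I)) ^ (1 / 2 : ℂ) := by
    rw [integral_gaussianReal_eq_integral_smul (by norm_num), ← integral_gaussian_complex (by simp),
      ← integral_const_mul]
    refine integral_congr_ae (.of_forall fun x => ?_)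
    simp only [gaussianPDFReal, Complex.real_smul]
    push_cast
    rw [mul_assoc, ← Complex.exp_add]
    congr 2
    · have : (Real.sqrt 2 : ℂ) ≠ 0 := by simp
      norm_num
      field_simp
    · ring
  rw [integral_complexGaussian]
  simp_rw [h]
  rw [integral_prod_mul (fun x : ℝ => Complex.exp (t * x ^ 2 * Complex.I))
    (fun x : ℝ => Complex.exp (t * x ^ 2 * Complex.I)), h1]
  have h2 : (1 - t * Complex.I : ℂ) ≠ 0 := fun h => by simpa using congrArg Complex.re h
  have h3 : ((Real.pi / (1 - t * Complex.I) : ℂ) ^ (1 / 2 : ℂ)) ^ 2 =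
      Real.pi / (1 - t * Complex.I) := by
    rw [← Complex.cpow_nat_mul]
    simp
  have h4 : (Real.sqrt Real.pi : ℂ) ^ 2 = Real.pi := by
    rw [← Complex.ofReal_pow, Real.sq_sqrt Real.pi_pos.le]
  have h5 : (Real.pi : ℂ) ≠ 0 := by exact_mod_cast Real.pi_ne_zero
  rw [mul_mul_mul_comm, ← sq, ← sq, h3, inv_pow, h4]
  field_simp

/-! ### Fischer's inequality and the determinant of a channel -/

/-- **Fischer's inequality** for the splitting of the first coordinate: the determinant of a
positive definite matrix is at most the product of its first diagonal entry and the complementary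
principal minor. -/
theorem det_le_mul_det_submatrix_succ {m : ℕ} {M : Matrix (Fin (m + 1)) (Fin (m + 1)) ℂ}
    (hM : M.PosDef) : M.det ≤ M 0 0 * (M.submatrix Fin.succ Fin.succ).det := by
  let e : Unit ⊕ Fin m ≃ Fin (m + 1) :=
    (Equiv.sumComm _ _).trans ((Equiv.optionEquivSumPUnit (Fin m)).symm.trans
      (finSuccEquiv m).symm)
  have e1 : ∀ i, e (Sum.inr i) = i.succ := fun i => rfl
  have e0 : ∀ i, e (Sum.inl i) = 0 := fun i => rfl
  set A : Matrix Unit Unit ℂ := fun _ _ => M 0 0 with hA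
  set B : Matrix Unit (Fin m) ℂ := fun _ j => M 0 j.succ with hB
  set D : Matrix (Fin m) (Fin m) ℂ := M.submatrix Fin.succ Fin.succ with hD
  have hDpos : D.PosDef := hM.submatrix (Fin.succ_injective m)
  have hblock : M.submatrix e e = Matrix.fromBlocks A B Bᴴ D := by
    ext (i | i) (j | j)
    · rfl
    · rfl
    · change M (Fin.succ i) 0 = star (M 0 i.succ)
      exact (hM.1.apply _ _).symm
    · rfl
  -- By the Schur complement `det M = det D * (M₀₀ - B D⁻¹ Bᴴ)`, and `B D⁻¹ Bᴴ` is nonnegative.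
  rw [← Matrix.det_submatrix_equiv_self e, hblock]
  have : Invertible D := hDpos.isUnit.invertible
  rw [Matrix.det_fromBlocks₂₂, mul_comm]
  refine mul_le_mul_of_nonneg_right ?_ hDpos.det_pos.le
  have hq : 0 ≤ (B * D⁻¹ * Bᴴ) () () :=
    (hDpos.inv.posSemidef.mul_mul_conjTranspose_same B).diag_nonneg
  rw [Matrix.det_unique, Matrix.invOf_eq_nonsing_inv, Matrix.sub_apply]
  exact sub_le_self _ hq

/-- The matrix `I + c ∑ⱼ wⱼ hⱼ hⱼᴴ` built from the columns `hⱼ` of a channel matrix and the powers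
`wⱼ` carried by these columns. The weights are indexed by `ℕ` so that passing to the
remaining columns is a shift. -/
noncomputable def columnGram (c : ℝ) (w : ℕ → ℝ) {n m : ℕ} (H : Fin n → Fin m → ℂ) :
    Matrix (Fin m) (Fin m) ℂ :=
  1 + ∑ j : Fin n, ((c * w j : ℝ) : ℂ) • Matrix.vecMulVec (H j) (star (H j))

theorem posDef_columnGram {c : ℝ} (hc : 0 ≤ c) {w : ℕ → ℝ} (hw : ∀ j, 0 ≤ w j) {n m : ℕ}
    (H : Fin n → Fin m → ℂ) : (columnGram c w H).PosDef := by
  refine Matrix.PosDef.one.add_posSemidef (Matrix.posSemidef_sum _ fun j _ => ?_)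
  exact (Matrix.posSemidef_vecMulVec_self_star (H j)).smul
    (by exact_mod_cast mul_nonneg hc (hw j))

theorem det_columnGram_mulVec (c : ℝ) (w : ℕ → ℝ) {n m : ℕ} (H : Fin n → Fin m → ℂ)
    {Q : Matrix (Fin m) (Fin m) ℂ} (hQ : Q ∈ Matrix.unitaryGroup (Fin m) ℂ) :
    (columnGram c w fun j => Q *ᵥ H j).det = (columnGram c w H).det := by
  have hQ' : Q * Qᴴ = 1 := Matrix.mem_unitaryGroup_iff.1 hQ
  have : columnGram c w (fun j => Q *ᵥ H j) = Q * columnGram c w H * Qᴴ := by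
    simp only [columnGram, mul_add, add_mul, mul_one, hQ', Finset.mul_sum, Finset.sum_mul,
      Matrix.mul_smul, Matrix.smul_mul, Matrix.star_mulVec, Matrix.mul_vecMulVec,
      Matrix.vecMulVec_mul]
  rw [this, Matrix.det_mul, Matrix.det_mul, mul_right_comm, ← Matrix.det_mul, hQ', Matrix.det_one,
    one_mul]

theorem continuous_det_columnGram (c : ℝ) (w : ℕ → ℝ) (n m : ℕ) :
    Continuous fun H : Fin n → Fin m → ℂ => (columnGram c w H).det.re := by
  refine Complex.continuous_re.comp (Continuous.matrix_det ?_)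
  refine continuous_const.add (continuous_finsetSum _ fun j _ =>
    (Continuous.matrix_vecMulVec ?_ ?_).fun_const_smul _) <;> fun_prop

/-- The first diagonal entry is one plus `c` times the power of the first row. -/
theorem columnGram_cons_zero_zero (c : ℝ) (w : ℕ → ℝ) {n m : ℕ} (a : Fin (m + 1) → ℂ)
    (h : Fin n → Fin (m + 1) → ℂ) :
    columnGram c w (Fin.cons a h : Fin (n + 1) → Fin (m + 1) → ℂ) 0 0 =
      ((1 + c * (w 0 * ‖a 0‖ ^ 2 + ∑ j : Fin n, w (j + 1) * ‖h j 0‖ ^ 2) : ℝ) : ℂ) := by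
  have hn : ∀ z : ℂ, z * (starRingEnd ℂ) z = ((‖z‖ ^ 2 : ℝ) : ℂ) := fun z => by
    rw [Complex.mul_conj, Complex.normSq_eq_norm_sq]
  simp only [columnGram, Fin.sum_univ_succ, Matrix.add_apply, Matrix.one_apply_eq,
    Matrix.smul_apply, Matrix.sum_apply, Matrix.vecMulVec_apply, Fin.cons_zero, Fin.cons_succ, Pi.star_apply,
    RCLike.star_def, hn, smul_eq_mul, Fin.val_zero, Fin.val_succ]
  push_cast
  rw [mul_add, Finset.mul_sum]
  simp only [mul_assoc]

/-- A first column supported on the first coordinate does not contribute to the complementary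
block. -/
theorem columnGram_cons_submatrix_succ (c : ℝ) (w : ℕ → ℝ) {n m : ℕ} {a : Fin (m + 1) → ℂ}
    (ha : ∀ i : Fin m, a i.succ = 0) (h : Fin n → Fin (m + 1) → ℂ) :
    (columnGram c w (Fin.cons a h : Fin (n + 1) → Fin (m + 1) → ℂ)).submatrix Fin.succ Fin.succ =
      columnGram c (fun j => w (j + 1)) fun j (i : Fin m) => h j i.succ := by
  ext i k
  simp [columnGram, Fin.sum_univ_succ, Matrix.sum_apply, Matrix.vecMulVec_apply, ha,
    Matrix.one_apply]

/-- If the first column is a multiple of the first basis vector, then bounding the power of the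
first row and the determinant of the remaining block bounds the whole determinant. -/
theorem det_columnGram_cons_lt {c : ℝ} (hc : 0 < c) {w : ℕ → ℝ} (hw : ∀ j, 0 ≤ w j) {n m : ℕ}
    {a : Fin (m + 1) → ℂ} (ha : ∀ i : Fin m, a i.succ = 0) {h : Fin n → Fin (m + 1) → ℂ} {x B : ℝ}
    (hx : w 0 * ‖a 0‖ ^ 2 + ∑ j : Fin n, w (j + 1) * ‖h j 0‖ ^ 2 < x)
    (hB : (columnGram c (fun j => w (j + 1)) fun j (i : Fin m) => h j i.succ).det.re ≤ B) :
    (columnGram c w (Fin.cons a h : Fin (n + 1) → Fin (m + 1) → ℂ)).det.re < (1 + c * x) * B := by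
  have h1 := det_le_mul_det_submatrix_succ
    (posDef_columnGram hc.le hw (Fin.cons a h : Fin (n + 1) → Fin (m + 1) → ℂ))
  rw [columnGram_cons_submatrix_succ c w ha, columnGram_cons_zero_zero] at h1
  set y := w 0 * ‖a 0‖ ^ 2 + ∑ j : Fin n, w (j + 1) * ‖h j 0‖ ^ 2 with hy
  have hy0 : 0 ≤ y := add_nonneg (mul_nonneg (hw _) (sq_nonneg _))
    (Finset.sum_nonneg fun j _ => mul_nonneg (hw _) (sq_nonneg _))
  set d := (columnGram c (fun j => w (j + 1)) fun j (i : Fin m) => h j i.succ).det with hd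
  have hd0 : 0 < d.re := (Complex.lt_def.1 (posDef_columnGram hc.le (fun j => hw (j + 1))
    (fun j (i : Fin m) => h j i.succ)).det_pos).1
  have h2 := (Complex.le_def.1 h1).1
  rw [Complex.re_ofReal_mul] at h2
  have h3 : c * y < c * x := mul_lt_mul_of_pos_left hx hc
  have h4 : 0 ≤ c * y := mul_nonneg hc.le hy0
  calc _ ≤ (1 + c * y) * d.re := h2
    _ < (1 + c * x) * d.re := by gcongr
    _ ≤ (1 + c * x) * B := by gcongr; linarith

/-- A unitary change of coordinates moving a given vector into the first coordinate axis. -/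
theorem exists_unitary_mulVec_eq {m : ℕ} (a : Fin (m + 1) → ℂ) :
    ∃ Q ∈ Matrix.unitaryGroup (Fin (m + 1)) ℂ, (∀ i : Fin m, (Q *ᵥ a) i.succ = 0) ∧
      ‖(Q *ᵥ a) 0‖ ^ 2 = ∑ i, ‖a i‖ ^ 2 := by
  set v : EuclideanSpace ℂ (Fin (m + 1)) := WithLp.toLp 2 a with hv
  by_cases h0 : v = 0
  · have ha : a = 0 := by simpa [hv] using h0
    exact ⟨1, one_mem _, by simp [ha], by simp [ha]⟩
  have hne : ‖v‖ ≠ 0 := norm_ne_zero_iff.2 h0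
  have horth : Orthonormal ℂ (({0} : Set (Fin (m + 1))).domRestrict
      fun _ => ((‖v‖ : ℂ)⁻¹ • v)) := by
    refine ⟨fun i => ?_, fun i j hij => (hij (Subsingleton.elim _ _)).elim⟩
    change ‖(‖v‖ : ℂ)⁻¹ • v‖ = 1
    simp [norm_smul, hne]
  obtain ⟨b, hb⟩ := horth.exists_orthonormalBasis_extension_of_card_eq (by simp)
  have hb0 : v = (‖v‖ : ℂ) • b 0 := by
    rw [hb 0 rfl, smul_inv_smul₀ (by exact_mod_cast hne)]
  have hQa : ∀ i, (Matrix.of (fun i k => star (b i k)) *ᵥ a) i =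
      inner ℂ (b i) v := by
    intro i
    simp [Matrix.mulVec, dotProduct, PiLp.inner_apply, hv, mul_comm]
  refine ⟨Matrix.of fun i k => star (b i k), ?_, fun i => ?_, ?_⟩
  · rw [Matrix.mem_unitaryGroup_iff]
    ext i j
    have := orthonormal_iff_ite.1 b.orthonormal i j
    rw [PiLp.inner_apply] at this
    simpa [Matrix.mul_apply, Matrix.one_apply, mul_comm] using this
  · rw [hQa, hb0, inner_smul_right, b.orthonormal.2 (Fin.succ_ne_zero i), mul_zero]
  · have : ‖v‖ ^ 2 = ∑ i, ‖a i‖ ^ 2 := EuclideanSpace.norm_sq_eq v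
    rw [hQa, ← this]
    nth_rewrite 1 [hb0]
    rw [inner_smul_right, inner_self_eq_norm_sq_to_K]
    simp

/-! ### Triangularization of a Gaussian matrix -/

/-- The law of `n` independent columns with `m` independent standard circularly symmetric complex
Gaussian entries each. -/
noncomputable def columnsLaw (n m : ℕ) : Measure (Fin n → Fin m → ℂ) :=
  Measure.pi fun _ => Measure.pi fun _ => complexGaussian

instance (n m : ℕ) : IsProbabilityMeasure (columnsLaw n m) := by
  unfold columnsLaw; infer_instance

/-- The power `w₀ ∑ᵢ |aᵢ|² + ∑ⱼ wⱼ₊₁ |zⱼ|²` of the first row of the triangularized channel: the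
first column, of length `m`, contributes its whole power, the `n` others one entry each. -/
noncomputable def rowPower {m n : ℕ} (w : ℕ → ℝ) (p : (Fin m → ℂ) × (Fin n → ℂ)) : ℝ :=
  w 0 * ∑ i, ‖p.1 i‖ ^ 2 + ∑ j : Fin n, w (j + 1) * ‖p.2 j‖ ^ 2

theorem continuous_rowPower {m n : ℕ} (w : ℕ → ℝ) :
    Continuous (rowPower w : (Fin m → ℂ) × (Fin n → ℂ) → ℝ) := by
  unfold rowPower
  fun_prop

/-- The distribution function at `x` of `rowPower w` for independent standard circularly symmetric
complex Gaussian variables. -/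
noncomputable def rowProb (m n : ℕ) (w : ℕ → ℝ) (x : ℝ) : ENNReal :=
  ((Measure.pi fun _ : Fin m => complexGaussian).prod
    (Measure.pi fun _ : Fin n => complexGaussian)) {p | rowPower w p < x}

/-- Splitting off the first row of a Gaussian matrix. -/
theorem measurePreserving_splitRow (n m : ℕ) :
    MeasurePreserving (fun h : Fin n → Fin (m + 1) → ℂ =>
      ((fun j => h j 0, fun j i => h j i.succ) : (Fin n → ℂ) × (Fin n → Fin m → ℂ)))
      (columnsLaw n (m + 1)) ((Measure.pi fun _ => complexGaussian).prod (columnsLaw n m)) := by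
  have h1 : MeasurePreserving
      (fun a : Fin (m + 1) → ℂ => ((a 0, fun i => a i.succ) : ℂ × (Fin m → ℂ)))
      (Measure.pi fun _ => complexGaussian)
      (complexGaussian.prod (Measure.pi fun _ => complexGaussian)) :=
    measurePreserving_piFinSuccAbove (fun _ => complexGaussian) 0
  have h2 := measurePreserving_pi
    (fun _ : Fin n => Measure.pi fun _ : Fin (m + 1) => complexGaussian)
    (fun _ => complexGaussian.prod (Measure.pi fun _ : Fin m => complexGaussian)) (fun _ => h1)
  exact (measurePreserving_arrowProdEquivProdArrow ℂ (Fin m → ℂ) (Fin n)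
    (fun _ => complexGaussian) (fun _ => Measure.pi fun _ : Fin m => complexGaussian)).comp h2

/-- Assembling a Gaussian matrix from its first column and the others. -/
theorem measurePreserving_consColumn (n m : ℕ) :
    MeasurePreserving (fun p : (Fin m → ℂ) × (Fin n → Fin m → ℂ) =>
      (Fin.cons p.1 p.2 : Fin (n + 1) → Fin m → ℂ))
      ((Measure.pi fun _ => complexGaussian).prod (columnsLaw n m)) (columnsLaw (n + 1) m) := by
  have h := (measurePreserving_piFinSuccAbove
    (fun _ : Fin (n + 1) => Measure.pi fun _ : Fin m => complexGaussian) 0).symm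
  have he : (fun p : (Fin m → ℂ) × (Fin n → Fin m → ℂ) =>
      (Fin.cons p.1 p.2 : Fin (n + 1) → Fin m → ℂ)) =
      (MeasurableEquiv.piFinSuccAbove (fun _ => Fin m → ℂ) 0).symm := by
    ext p i
    simp [MeasurableEquiv.piFinSuccAbove, Fin.insertNthEquiv]
  rw [he]
  exact h

/-- Left multiplication by a unitary matrix preserves the law of a Gaussian matrix. -/
theorem measurePreserving_columns_mulVec {n m : ℕ} {Q : Matrix (Fin m) (Fin m) ℂ}
    (hQ : Q ∈ Matrix.unitaryGroup (Fin m) ℂ) :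
    MeasurePreserving (fun (h : Fin n → Fin m → ℂ) j => Q *ᵥ h j)
      (columnsLaw n m) (columnsLaw n m) :=
  measurePreserving_pi _ _ fun _ => measurePreserving_unitary_mulVec hQ

/-- One triangularization step. Conditionally on the first column, a unitary change of coordinates
moves it to the first coordinate axis and keeps the law of the other columns, after which the
first row is independent of the remaining block. -/
theorem rowProb_mul_le {c : ℝ} (hc : 0 < c) {w : ℕ → ℝ} (hw : ∀ j, 0 ≤ w j) (n m : ℕ) (x B : ℝ) :
    rowProb (m + 1) n w x * columnsLaw n m {H | (columnGram c (fun j => w (j + 1)) H).det.re ≤ B} ≤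
      columnsLaw (n + 1) (m + 1) {H | (columnGram c w H).det.re < (1 + c * x) * B} := by
  have hms : MeasurableSet {H : Fin (n + 1) → Fin (m + 1) → ℂ |
      (columnGram c w H).det.re < (1 + c * x) * B} :=
    (isOpen_lt (continuous_det_columnGram c w _ _) continuous_const).measurableSet
  have hmr : MeasurableSet {p : (Fin (m + 1) → ℂ) × (Fin n → ℂ) | rowPower w p < x} :=
    (isOpen_lt (continuous_rowPower w) continuous_const).measurableSet
  set T : Set (Fin n → Fin m → ℂ) := {H | (columnGram c (fun j => w (j + 1)) H).det.re ≤ B} with hT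
  have hmT : MeasurableSet T :=
    (isClosed_le (continuous_det_columnGram c _ _ _) continuous_const).measurableSet
  rw [rowProb, Measure.prod_apply hmr,
    ← (measurePreserving_consColumn n (m + 1)).measure_preimage hms.nullMeasurableSet,
    Measure.prod_apply ((measurePreserving_consColumn n (m + 1)).measurable hms),
    ← lintegral_mul_const' _ _ (measure_ne_top _ _)]
  refine lintegral_mono fun a => ?_
  obtain ⟨Q, hQ, hQ0, hQn⟩ := exists_unitary_mulVec_eq a
  have hmS : MeasurableSet
      (Prod.mk a ⁻¹' {p : (Fin (m + 1) → ℂ) × (Fin n → ℂ) | rowPower w p < x}) :=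
    measurable_prodMk_left hmr
  have hsplit := measurePreserving_splitRow n m
  have hcol := measurePreserving_columns_mulVec (n := n) hQ
  change _ * columnsLaw n m T ≤ _
  rw [← Measure.prod_prod, ← hsplit.measure_preimage (hmS.prod hmT).nullMeasurableSet,
    ← hcol.measure_preimage (hsplit.measurable (hmS.prod hmT)).nullMeasurableSet]
  refine measure_mono fun h hh => ?_
  obtain ⟨h1, h2⟩ := hh
  have h3 := det_columnGram_cons_lt hc hw hQ0 (h := fun j => Q *ᵥ h j) (x := x) (B := B)
    (by rw [hQn]; exact h1) h2
  change (columnGram c w (Fin.cons a h : Fin (n + 1) → Fin (m + 1) → ℂ)).det.re < _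
  rw [← det_columnGram_mulVec c w _ hQ]
  convert h3 using 5
  rename_i j
  refine Fin.cases ?_ (fun j => ?_) j <;> rfl

/-- Removing the first row and column shifts the weights and the thresholds. -/
theorem prod_rowProb_succ (n m : ℕ) (w : ℕ → ℝ) (x : ℕ → ℝ) :
    ∏ l ∈ Finset.range (min (n + 1) (m + 1)),
        rowProb (m + 1 - l) (n + 1 - 1 - l) (fun j => w (l + j)) (x l) =
      rowProb (m + 1) n w (x 0) * ∏ l ∈ Finset.range (min n m),
        rowProb (m - l) (n - 1 - l) (fun j => w (l + j + 1)) (x (l + 1)) := by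
  rw [Nat.add_min_add_right, Finset.prod_range_succ', mul_comm]
  congr 1
  · simp
  · refine Finset.prod_congr rfl fun l _ => ?_
    congr 1
    · omega
    · omega
    · funext j
      congr 1
      omega

/-- Triangularization of all columns: the powers of the rows of the triangularized channel are
independent, and the determinant is bounded by the product of the diagonal entries. Row `l`
(counted from zero) receives a column of length `m - l` and one entry of each of the
`n - 1 - l` columns after it. The event has `≤` because the empty product is attained when
no column or no row is left. -/
theorem prod_rowProb_le {c : ℝ} (hc : 0 < c) (n : ℕ) : ∀ (m : ℕ) (w : ℕ → ℝ) (x : ℕ → ℝ),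
    (∀ j, 0 ≤ w j) →
    ∏ l ∈ Finset.range (min n m), rowProb (m - l) (n - 1 - l) (fun j => w (l + j)) (x l) ≤
      columnsLaw n m {H | (columnGram c w H).det.re ≤
        ∏ l ∈ Finset.range (min n m), (1 + c * x l)} := by
  induction n with
  | zero =>
    intro m w x hw
    simp [columnGram]
  | succ n ih =>
    intro m w x hw
    cases m with
    | zero => simp
    | succ m =>
      rw [prod_rowProb_succ]
      refine (mul_le_mul_right (ih m (fun j => w (j + 1)) (fun l => x (l + 1))
        fun j => hw (j + 1)) _).trans ?_
      refine (rowProb_mul_le hc hw n m (x 0) _).trans (measure_mono fun H hH => ?_)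
      rw [Nat.add_min_add_right, Finset.prod_range_succ', mul_comm]
      exact le_of_lt (α := ℝ) hH

/-- The bound of `prod_rowProb_le` with a strict inequality for the determinant, which the first
triangularization step provides as soon as there are a row and a column. -/
theorem prod_rowProb_le_lt {c : ℝ} (hc : 0 < c) {n m : ℕ} (hn : 1 ≤ n) (hm : 1 ≤ m) {w : ℕ → ℝ}
    (hw : ∀ j, 0 ≤ w j) (x : ℕ → ℝ) :
    ∏ l ∈ Finset.range (min n m), rowProb (m - l) (n - 1 - l) (fun j => w (l + j)) (x l) ≤
      columnsLaw n m {H | (columnGram c w H).det.re <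
        ∏ l ∈ Finset.range (min n m), (1 + c * x l)} := by
  obtain ⟨n, rfl⟩ := Nat.exists_eq_add_of_le' hn
  obtain ⟨m, rfl⟩ := Nat.exists_eq_add_of_le' hm
  rw [prod_rowProb_succ]
  refine (mul_le_mul_right (prod_rowProb_le hc n m (fun j => w (j + 1)) (fun l => x (l + 1))
    fun j => hw (j + 1)) _).trans ?_
  refine (rowProb_mul_le hc hw n m (x 0) _).trans (measure_mono fun H hH => ?_)
  rw [Nat.add_min_add_right, Finset.prod_range_succ', mul_comm (Finset.prod _ _)]
  exact hH

/-! ### Weighted sums of exponential variables and Gamma laws -/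

theorem one_sub_mul_I_mul_ne_zero (t a : ℝ) : (1 - t * Complex.I * a : ℂ) ≠ 0 :=
  fun h => by simpa using congrArg Complex.re h

/-- The characteristic function of a weighted sum of squared moduli of independent standard
circularly symmetric complex Gaussian variables. -/
theorem integral_exp_sum_normSq {ι : Type*} [Fintype ι] (w : ι → ℝ) (t : ℝ) :
    ∫ z : ι → ℂ, Complex.exp ((t * ∑ i, w i * ‖z i‖ ^ 2 : ℝ) * Complex.I)
        ∂(Measure.pi fun _ => complexGaussian) =
      ∏ i, (1 - t * Complex.I * w i)⁻¹ := by
  have h : ∀ z : ι → ℂ, Complex.exp ((t * ∑ i, w i * ‖z i‖ ^ 2 : ℝ) * Complex.I) =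
      ∏ i, Complex.exp ((t * w i * ‖z i‖ ^ 2 : ℝ) * Complex.I) := by
    intro z
    rw [← Complex.exp_sum, Finset.mul_sum, Complex.ofReal_sum, Finset.sum_mul]
    simp only [mul_assoc]
  simp_rw [h]
  rw [integral_fintype_prod_eq_prod
    (f := fun (i : ι) z => Complex.exp ((t * w i * ‖z‖ ^ 2 : ℝ) * Complex.I))]
  refine Finset.prod_congr rfl fun i _ => ?_
  rw [integral_exp_normSq_complexGaussian]
  push_cast
  ring

/-- The law of `rowPower w` for independent standard circularly symmetric complex Gaussian
variables. -/
noncomputable def rowLaw (m n : ℕ) (w : ℕ → ℝ) : Measure ℝ :=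
  ((Measure.pi fun _ : Fin m => complexGaussian).prod
    (Measure.pi fun _ : Fin n => complexGaussian)).map (rowPower w)

instance (m n : ℕ) (w : ℕ → ℝ) : IsProbabilityMeasure (rowLaw m n w) :=
  Measure.isProbabilityMeasure_map (continuous_rowPower w).measurable.aemeasurable

theorem rowProb_toReal (m n : ℕ) (w : ℕ → ℝ) (x : ℝ) :
    (rowProb m n w x).toReal = (rowLaw m n w).real (Set.Iio x) := by
  rw [Measure.real, rowLaw, Measure.map_apply (continuous_rowPower w).measurable measurableSet_Iio]
  rfl

theorem charFun_rowLaw (m n : ℕ) (w : ℕ → ℝ) (t : ℝ) :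
    charFun (rowLaw m n w) t = ((1 - t * Complex.I * w 0) ^ m)⁻¹ *
      ∏ j : Fin n, (1 - t * Complex.I * w (j + 1))⁻¹ := by
  have h : ∀ p : (Fin m → ℂ) × (Fin n → ℂ),
      Complex.exp (t * (rowPower w p : ℝ) * Complex.I) =
        Complex.exp ((t * ∑ i, w 0 * ‖p.1 i‖ ^ 2 : ℝ) * Complex.I) *
        Complex.exp ((t * ∑ j : Fin n, w (j + 1) * ‖p.2 j‖ ^ 2 : ℝ) * Complex.I) := by
    intro p
    rw [← Complex.exp_add, rowPower, Finset.mul_sum]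
    congr 1
    push_cast
    ring
  rw [charFun_apply_real, rowLaw,
    integral_map (continuous_rowPower w).measurable.aemeasurable (by fun_prop)]
  simp_rw [h]
  rw [integral_prod_mul
    (fun a : Fin m → ℂ => Complex.exp ((t * ∑ i, w 0 * ‖a i‖ ^ 2 : ℝ) * Complex.I))
    (fun z : Fin n → ℂ => Complex.exp ((t * ∑ j : Fin n, w (j + 1) * ‖z j‖ ^ 2 : ℝ) * Complex.I)),
    integral_exp_sum_normSq, integral_exp_sum_normSq]
  simp

/-- The Gamma law with integral shape `k ≥ 1` and scale `θ`, as the image of the law of scale one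
under `x ↦ θ x`. The shape `k = 0` gives the same measure as `k = 1`. -/
noncomputable def erlangLaw (k : ℕ) (θ : ℝ) : Measure ℝ :=
  ((volume.restrict (Set.Ioi (0 : ℝ))).withDensity fun x =>
    ENNReal.ofReal (x ^ (k - 1) * Real.exp (-x) / (k - 1)!)).map (θ * ·)

theorem integrableOn_pow_mul_exp_neg (k : ℕ) :
    IntegrableOn (fun x : ℝ => x ^ k * Real.exp (-x)) (Set.Ioi 0) := by
  have h := Real.GammaIntegral_convergent (s := k + 1) (by positivity)
  refine h.congr_fun (fun x _ => ?_) measurableSet_Ioi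
  simp only [add_sub_cancel_right, Real.rpow_natCast]
  ring

instance (k : ℕ) (θ : ℝ) : IsFiniteMeasure (erlangLaw k θ) := by
  have : IsFiniteMeasure ((volume.restrict (Set.Ioi (0 : ℝ))).withDensity fun x =>
      ENNReal.ofReal (x ^ (k - 1) * Real.exp (-x) / (k - 1)!)) :=
    isFiniteMeasure_withDensity_ofReal ((integrableOn_pow_mul_exp_neg (k - 1)).div_const _).2
  unfold erlangLaw
  infer_instance

/-- The Gamma integral of integral order with the complex rate `1 - it`, obtained by repeated
integration by parts. -/
theorem integral_pow_mul_cexp_neg (t : ℝ) (k : ℕ) :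
    ∫ x in Set.Ioi (0 : ℝ), (x : ℂ) ^ k * Complex.exp (-((1 - t * Complex.I) * x)) =
      k ! / (1 - t * Complex.I) ^ (k + 1) := by
  set b : ℂ := 1 - t * Complex.I with hb
  have hb0 : b ≠ 0 := by simpa using one_sub_mul_I_mul_ne_zero t 1
  have hnorm : ∀ (k : ℕ) (x : ℝ), 0 ≤ x →
      ‖(x : ℂ) ^ k * Complex.exp (-(b * x))‖ = x ^ k * Real.exp (-x) := by
    intro k x hx
    rw [norm_mul, Complex.norm_exp, norm_pow, Complex.norm_real, Real.norm_of_nonneg hx]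
    simp [hb]
  have hint : ∀ k : ℕ, IntegrableOn (fun x : ℝ => (x : ℂ) ^ k * Complex.exp (-(b * x)))
      (Set.Ioi 0) := by
    intro k
    refine (integrableOn_pow_mul_exp_neg k).mono' (by fun_prop) ?_
    exact (ae_restrict_iff' measurableSet_Ioi).2 (.of_forall fun x hx => (hnorm k x hx.le).le)
  have htend : ∀ k : ℕ, Filter.Tendsto (fun x : ℝ => (x : ℂ) ^ k * Complex.exp (-(b * x)))
      Filter.atTop (nhds 0) := by
    intro k
    refine tendsto_zero_iff_norm_tendsto_zero.2 ?_
    refine (Real.tendsto_pow_mul_exp_neg_atTop_nhds_zero k).congr' ?_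
    filter_upwards [Filter.eventually_ge_atTop 0] with x hx using (hnorm k x hx).symm
  have hexp : ∀ x : ℝ, HasDerivAt (fun x : ℝ => Complex.exp (-(b * x)))
      (Complex.exp (-(b * x)) * -(b * 1)) x := fun x =>
    ((Complex.ofRealCLM.hasDerivAt (x := x)).const_mul b).neg.cexp
  induction k with
  | zero =>
    have h := integral_Ioi_of_hasDerivAt_of_tendsto' (a := 0) (fun x _ => hexp x)
      (by simpa only [IntegrableOn, pow_zero, one_mul] using (hint 0).mul_const (-(b * 1)))
      (by simpa using htend 0)
    rw [integral_mul_const] at h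
    simp only [pow_zero, one_mul, zero_add, pow_one, Nat.factorial_zero, Nat.cast_one]
    rw [eq_div_iff hb0]
    simp only [Complex.ofReal_zero, mul_zero, neg_zero, Complex.exp_zero] at h
    linear_combination -h
  | succ k ih =>
    have hder : ∀ x : ℝ, HasDerivAt (fun x : ℝ => (x : ℂ) ^ (k + 1) * Complex.exp (-(b * x)))
        ((k + 1) * ((x : ℂ) ^ k * Complex.exp (-(b * x))) -
          b * ((x : ℂ) ^ (k + 1) * Complex.exp (-(b * x)))) x := by
      intro x
      have h1 : HasDerivAt (fun x : ℝ => (x : ℂ) ^ (k + 1) * Complex.exp (-(b * x))) _ x :=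
        ((Complex.ofRealCLM.hasDerivAt (x := x)).pow (k + 1)).mul (hexp x)
      refine h1.congr_deriv ?_
      simp
      ring
    have h := integral_Ioi_of_hasDerivAt_of_tendsto' (a := 0) (fun x _ => hder x)
      (((hint k).const_mul _).sub ((hint (k + 1)).const_mul _)) (htend (k + 1))
    rw [integral_sub ((hint k).const_mul _) ((hint (k + 1)).const_mul _), integral_const_mul,
      integral_const_mul, ih] at h
    simp only [Complex.ofReal_zero, zero_pow (Nat.succ_ne_zero k), zero_mul, sub_zero] at h
    have h2 := sub_eq_zero.1 h
    rw [Nat.factorial_succ]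
    push_cast
    rw [eq_div_iff (pow_ne_zero _ hb0)]
    field_simp at h2
    rw [pow_succ, pow_succ]
    rw [pow_succ] at h2
    linear_combination -h2

theorem charFun_erlangLaw {k : ℕ} (hk : 1 ≤ k) (θ t : ℝ) :
    charFun (erlangLaw k θ) t = ((1 - t * Complex.I * θ) ^ k)⁻¹ := by
  obtain ⟨k, rfl⟩ := Nat.exists_eq_add_of_le' hk
  rw [charFun_apply_real, erlangLaw, integral_map (by fun_prop) (by fun_prop),
    integral_withDensity_eq_integral_toReal_smul (by fun_prop) (.of_forall fun x => by simp)]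
  have h := integral_pow_mul_cexp_neg (t * θ) k
  have hf : (k ! : ℂ) ≠ 0 := by exact_mod_cast Nat.factorial_ne_zero k
  calc _ = ∫ x in Set.Ioi (0 : ℝ), (k ! : ℂ)⁻¹ *
        ((x : ℂ) ^ k * Complex.exp (-((1 - (t * θ : ℝ) * Complex.I) * x))) := by
        refine setIntegral_congr_fun measurableSet_Ioi fun x hx => ?_
        have hx0 : (0 : ℝ) ≤ x := le_of_lt hx
        simp only [Nat.add_sub_cancel]
        rw [ENNReal.toReal_ofReal (by positivity), Complex.real_smul]
        push_cast
        rw [div_mul_eq_mul_div, mul_assoc, ← Complex.exp_add, div_eq_inv_mul]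
        congr 3
        ring
    _ = _ := by
        rw [integral_const_mul, h]
        push_cast
        field_simp

theorem erlangLaw_real_Iio {θ x : ℝ} (hθ : 0 < θ) (hx : 0 ≤ x) (k : ℕ) :
    (erlangLaw k θ).real (Set.Iio x) = gammaInc (x / θ) k := by
  have hpre : (fun y : ℝ => θ * y) ⁻¹' Set.Iio x = Set.Iio (x / θ) := by
    ext y
    simp [lt_div_iff₀' hθ]
  have hset : Set.Iio (x / θ) ∩ Set.Ioi 0 = Set.Ioo 0 (x / θ) := by
    ext y
    simp [and_comm]
  have hx' : 0 ≤ x / θ := by positivity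
  rw [Measure.real, erlangLaw, Measure.map_apply (by fun_prop) measurableSet_Iio, hpre,
    withDensity_apply _ measurableSet_Iio, Measure.restrict_restrict measurableSet_Iio, hset,
    ← ofReal_integral_eq_lintegral_ofReal, ENNReal.toReal_ofReal, gammaInc,
    intervalIntegral.integral_of_le hx', integral_Ioc_eq_integral_Ioo, integral_div]
  · ring
  · refine setIntegral_nonneg measurableSet_Ioo fun y hy => ?_
    have := hy.1.le
    positivity
  · exact ((integrableOn_pow_mul_exp_neg (k - 1)).mono_set Set.Ioo_subset_Ioi_self).div_const _
  · refine (ae_restrict_iff' measurableSet_Ioo).2 (.of_forall fun y hy => ?_)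
    have := hy.1.le
    simp only [Pi.zero_apply]
    positivity

/-- A finite measure whose characteristic function is a real linear combination of characteristic
functions of finite measures is the corresponding linear combination of these measures, even
when some of the coefficients are negative. -/
theorem measureReal_eq_sum_of_charFun {ι : Type*} (s : Finset ι) (μ : Measure ℝ)
    [IsFiniteMeasure μ] (ν : ι → Measure ℝ) [∀ i, IsFiniteMeasure (ν i)] (a : ι → ℝ)
    (h : ∀ t, charFun μ t = ∑ i ∈ s, a i * charFun (ν i) t) (A : Set ℝ) :
    μ.real A = ∑ i ∈ s, a i * (ν i).real A := by
  have hint : ∀ (ρ : Measure ℝ) [IsFiniteMeasure ρ] (t : ℝ),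
      Integrable (fun x : ℝ => Complex.exp (t * x * Complex.I)) ρ := by
    intro ρ _ t
    refine (integrable_const (1 : ℝ)).mono' (by fun_prop) (.of_forall fun x => ?_)
    rw [← Complex.ofReal_mul, Complex.norm_exp_ofReal_mul_I]
  have hchar : ∀ (c : ι → ℝ) (t : ℝ), charFun (∑ i ∈ s, (c i).toNNReal • ν i) t =
      ∑ i ∈ s, ((c i).toNNReal : ℝ) * charFun (ν i) t := by
    intro c t
    rw [charFun_apply_real, integral_finsetSum_measure fun i _ => hint _ t]
    refine Finset.sum_congr rfl fun i _ => ?_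
    rw [integral_smul_nnreal_measure, charFun_apply_real, NNReal.smul_def, Complex.real_smul]
  have hpos : ∀ r : ℝ, ((r.toNNReal : ℝ) - ((-r).toNNReal : ℝ)) = r := fun r => by
    rw [Real.coe_toNNReal', Real.coe_toNNReal']
    exact max_zero_sub_max_neg_zero_eq_self r
  -- The terms with negative coefficients are moved to the side of `μ`, so that both sides are
  -- finite (positive) measures.
  have hμ : μ + ∑ i ∈ s, (-a i).toNNReal • ν i = ∑ i ∈ s, (a i).toNNReal • ν i := by
    refine Measure.ext_of_charFun (funext fun t => ?_)
    have hadd : charFun (μ + ∑ i ∈ s, (-a i).toNNReal • ν i) t =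
        charFun μ t + charFun (∑ i ∈ s, (-a i).toNNReal • ν i) t := by
      simp only [charFun_apply_real]
      exact integral_add_measure (hint _ t) (hint _ t)
    rw [hadd, h, hchar (fun i => -a i), hchar, ← Finset.sum_add_distrib]
    refine Finset.sum_congr rfl fun i _ => ?_
    rw [← add_mul]
    congr 1
    rw [← Complex.ofReal_add]
    congr 1
    linarith [hpos (a i)]
  have hreal : ∀ c : ι → ℝ, (∑ i ∈ s, (c i).toNNReal • ν i).real A =
      ∑ i ∈ s, ((c i).toNNReal : ℝ) * (ν i).real A := by
    intro c
    rw [Measure.real, Measure.finsetSum_apply, ENNReal.toReal_sum fun i _ => measure_ne_top _ _]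
    refine Finset.sum_congr rfl fun i _ => ?_
    rw [Measure.smul_apply, ENNReal.smul_def, smul_eq_mul, ENNReal.toReal_mul]
    rfl
  have h1 : (μ + ∑ i ∈ s, (-a i).toNNReal • ν i).real A =
      (∑ i ∈ s, (a i).toNNReal • ν i).real A := by rw [hμ]
  rw [measureReal_add_apply, hreal (fun i => -a i), hreal] at h1
  rw [eq_sub_of_add_eq h1, ← Finset.sum_sub_distrib]
  refine Finset.sum_congr rfl fun i _ => ?_
  rw [← sub_mul, hpos]

/-! ### Partial fractions -/

theorem one_sub_inv_mul_eq_div {K : Type*} [Field K] {a b : K} (ha : a ≠ 0) :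
    1 - a⁻¹ * b = (a - b) / a := by
  rw [sub_div, div_self ha, inv_mul_eq_div]

/-- Relates the residue `(1 - α / β)⁻¹` at one pole to the residue at the other. -/
theorem inv_one_sub_inv_mul_swap {K : Type*} [Field K] {a b : K} (ha : a ≠ 0) (hb : b ≠ 0) :
    (1 - b⁻¹ * a)⁻¹ = -a⁻¹ * b * (1 - a⁻¹ * b)⁻¹ := by
  rw [one_sub_inv_mul_eq_div ha, one_sub_inv_mul_eq_div hb, inv_div, inv_div, ← neg_sub a b,
    div_neg]
  field_simp

/-- Partial fractions of `∏ⱼ (1 - z βⱼ)⁻¹` for distinct `βⱼ`: Lagrange interpolation of the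
constant `1` at the nodes `βⱼ⁻¹`. -/
theorem prod_inv_one_sub_mul_eq_sum {K ι : Type*} [Field K] [DecidableEq ι] {J : Finset ι}
    (hJ : J.Nonempty) {β : ι → K} (hβ : ∀ j ∈ J, β j ≠ 0) (hinj : Set.InjOn β J) {z : K}
    (hz : ∀ j ∈ J, 1 - z * β j ≠ 0) :
    ∏ j ∈ J, (1 - z * β j)⁻¹ =
      ∑ j ∈ J, (∏ i ∈ J.erase j, (1 - (β j)⁻¹ * β i)⁻¹) * (1 - z * β j)⁻¹ := by
  have hinj' : Set.InjOn (fun j => (β j)⁻¹) J := fun i hi j hj h => hinj hi hj (inv_injective h)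
  have h := congrArg (Polynomial.eval z) (Lagrange.sum_basis hinj' hJ)
  rw [Polynomial.eval_finsetSum, Polynomial.eval_one] at h
  have hmul : ∏ j ∈ J, (1 - z * β j)⁻¹ =
      (∑ j ∈ J, Polynomial.eval z (Lagrange.basis J (fun j => (β j)⁻¹) j)) *
        ∏ j ∈ J, (1 - z * β j)⁻¹ := by rw [h, one_mul]
  rw [hmul, Finset.sum_mul]
  refine Finset.sum_congr rfl fun j hj => ?_
  rw [Lagrange.basis, Polynomial.eval_prod, ← Finset.mul_prod_erase J _ hj, mul_left_comm,
    ← Finset.prod_mul_distrib, mul_comm]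
  congr 1
  refine Finset.prod_congr rfl fun i hi => ?_
  have hi' := Finset.mem_of_mem_erase hi
  have hne : β j - β i ≠ 0 :=
    sub_ne_zero.2 fun h => Finset.ne_of_mem_erase hi (hinj hj hi' h).symm
  have h1 := hβ i hi'
  have h2 := hβ j hj
  have h3 := hz i hi'
  have h4 : (β j)⁻¹ - (β i)⁻¹ = -((β j - β i) / (β i * β j)) := by field_simp; ring
  have h5 : 1 - (β j)⁻¹ * β i = (β j - β i) / β j := one_sub_inv_mul_eq_div h2
  have h6 : z - (β i)⁻¹ = -((1 - z * β i) / β i) := by field_simp; ring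
  simp only [Lagrange.basisDivisor, Polynomial.eval_mul, Polynomial.eval_C, Polynomial.eval_sub,
    Polynomial.eval_X]
  rw [h4, h5, h6]
  generalize 1 - z * β i = u at h3 ⊢
  field_simp

/-- Partial fractions with a pole of order `n` at `α⁻¹` and a simple pole at `β⁻¹`. -/
theorem inv_pow_mul_inv_eq_sum {K : Type*} [Field K] {α β z : K} (hα : α ≠ 0) (hβ : β ≠ 0)
    (hαβ : α ≠ β) (hzα : 1 - z * α ≠ 0) (hzβ : 1 - z * β ≠ 0) (n : ℕ) :
    ((1 - z * α) ^ n)⁻¹ * (1 - z * β)⁻¹ =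
      ∑ m ∈ Finset.range n, (1 - α⁻¹ * β)⁻¹ * ((1 - β⁻¹ * α)⁻¹) ^ m * ((1 - z * α) ^ (n - m))⁻¹ +
        ((1 - β⁻¹ * α)⁻¹) ^ n * (1 - z * β)⁻¹ := by
  have h1 : α - β ≠ 0 := sub_ne_zero.2 hαβ
  have h2 : β - α ≠ 0 := sub_ne_zero.2 hαβ.symm
  have h3 : (1 - α⁻¹ * β)⁻¹ = α / (α - β) := by
    rw [one_sub_inv_mul_eq_div hα, inv_div]
  have h4 : (1 - β⁻¹ * α)⁻¹ = β / (β - α) := by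
    rw [one_sub_inv_mul_eq_div hβ, inv_div]
  have hone : (1 - z * α)⁻¹ * (1 - z * β)⁻¹ =
      (1 - α⁻¹ * β)⁻¹ * (1 - z * α)⁻¹ + (1 - β⁻¹ * α)⁻¹ * (1 - z * β)⁻¹ := by
    rw [h3, h4, show β - α = -(α - β) by ring]
    field_simp
    ring
  induction n with
  | zero => simp
  | succ n ih =>
    have hs : ∀ m ∈ Finset.range n, (1 - α⁻¹ * β)⁻¹ * ((1 - β⁻¹ * α)⁻¹) ^ m *
        ((1 - z * α) ^ (n + 1 - m))⁻¹ = (1 - z * α)⁻¹ *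
          ((1 - α⁻¹ * β)⁻¹ * ((1 - β⁻¹ * α)⁻¹) ^ m * ((1 - z * α) ^ (n - m))⁻¹) := by
      intro m hm
      rw [Nat.succ_sub (Finset.mem_range.1 hm).le, pow_succ, mul_inv]
      ring
    rw [Finset.sum_range_succ, Finset.sum_congr rfl hs, ← Finset.mul_sum, pow_succ, mul_inv,
      Nat.add_sub_cancel_left, pow_one, pow_succ]
    linear_combination (1 - z * α)⁻¹ * ih + ((1 - β⁻¹ * α)⁻¹) ^ n * hone

theorem iteratedDeriv_inv_one_sub_mul (m : ℕ) (β s : ℝ) :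
    iteratedDeriv m (fun s : ℝ => (1 - s * β)⁻¹) s = m ! * β ^ m * ((1 - s * β) ^ (m + 1))⁻¹ := by
  have h : (fun s : ℝ => (1 - s * β)⁻¹) = fun s => (-β * s + 1)⁻¹ := by
    funext s
    ring
  rw [h, iteratedDeriv_eq_iterate, iter_deriv_inv_linear]
  have h1 : (-1 - m : ℤ) = -((m + 1 : ℕ) : ℤ) := by push_cast; ring
  simp only [h1, zpow_neg, zpow_natCast]
  rw [show -β * s + 1 = 1 - s * β by ring, neg_pow β]
  have h2 : ((-1 : ℝ) ^ m) * (-1) ^ m = 1 := by rw [← mul_pow]; simp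
  linear_combination (m ! * β ^ m * ((1 - s * β) ^ (m + 1))⁻¹) * h2

section Coefficients

variable {Nr Nt : ℕ} {D : Fin Nt → ℝ} {l : Fin Nt}

/-- When there are other columns, the coefficients at the multiple pole come from expanding each
term of the partial fractions of `headFun`. -/
theorem headCoeff_eq_sum (hD : ∀ k, D k ≠ 0) (hinj : Function.Injective fun k => D k ^ 2)
    (hJ : (Finset.Ioi l).Nonempty) {m : ℕ} (hm : m ≤ Nr - l) :
    headCoeff Nr D l (Nr - l - m) = ∑ j ∈ Finset.Ioi l,
      (∏ i ∈ (Finset.Ioi l).erase j, (1 - (D j ^ 2)⁻¹ * D i ^ 2)⁻¹) *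
        ((1 - (D l ^ 2)⁻¹ * D j ^ 2)⁻¹ * ((1 - (D j ^ 2)⁻¹ * D l ^ 2)⁻¹) ^ m) := by
  have hα : D l ^ 2 ≠ 0 := pow_ne_zero 2 (hD l)
  have hne : ∀ j ∈ Finset.Ioi l, D l ^ 2 - D j ^ 2 ≠ 0 := fun j hj =>
    sub_ne_zero.2 fun h => (Finset.mem_Ioi.1 hj).ne (hinj h)
  have hne' : ∀ j ∈ Finset.Ioi l, 1 - (D l ^ 2)⁻¹ * D j ^ 2 ≠ 0 := by
    intro j hj
    rw [one_sub_inv_mul_eq_div hα]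
    exact div_ne_zero (hne j hj) hα
  -- The identity fails at the other poles `(D j ^ 2)⁻¹`, where `0⁻¹ = 0`, hence only a local
  -- statement.
  have hev : headFun D l =ᶠ[nhds ((D l ^ 2)⁻¹)] fun s => ∑ j ∈ Finset.Ioi l,
      (∏ i ∈ (Finset.Ioi l).erase j, (1 - (D j ^ 2)⁻¹ * D i ^ 2)⁻¹) * (1 - s * D j ^ 2)⁻¹ := by
    have h : ∀ᶠ s in nhds ((D l ^ 2)⁻¹), ∀ j ∈ Finset.Ioi l, 1 - s * D j ^ 2 ≠ 0 := by
      refine (Filter.eventually_all_finset _).2 fun j hj => ?_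
      exact ContinuousAt.eventually_ne (by fun_prop) (hne' j hj)
    filter_upwards [h] with s hs
    exact prod_inv_one_sub_mul_eq_sum hJ (fun j _ => pow_ne_zero 2 (hD j))
      (hinj.injOn (s := _)) hs
  rw [headCoeff, Nat.sub_sub_self hm, hev.iteratedDeriv_eq, iteratedDeriv_fun_sum, Finset.mul_sum]
  · refine Finset.sum_congr rfl fun j hj => ?_
    have hβ : D j ^ 2 ≠ 0 := pow_ne_zero 2 (hD j)
    have hf : (m ! : ℝ) ≠ 0 := by exact_mod_cast Nat.factorial_ne_zero m
    rw [iteratedDeriv_const_mul_field, iteratedDeriv_inv_one_sub_mul,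
      inv_one_sub_inv_mul_swap hα hβ, div_mul_eq_mul_div, div_eq_iff hf]
    generalize D l ^ 2 = α
    generalize (1 - α⁻¹ * D j ^ 2) = p
    rw [mul_pow, mul_pow, pow_succ, mul_inv, ← inv_pow, ← inv_pow, ← neg_inv]
    ring
  · intro j hj
    have := hne' j hj
    refine contDiffAt_const.mul (ContDiffAt.inv (by fun_prop) this)

/-- For the last column `headFun` is constant and only the coefficient of highest order survives. -/
theorem headCoeff_of_Ioi_eq_empty (hJ : Finset.Ioi l = ∅) {k : ℕ} (hk : k ≤ Nr - l) :
    headCoeff Nr D l k = if k = Nr - l then 1 else 0 := by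
  have h : headFun D l = fun _ => 1 := by
    funext s
    simp [headFun, hJ]
  rw [headCoeff, h, iteratedDeriv_const]
  rcases hk.eq_or_lt with rfl | hlt
  · simp
  · rw [if_neg (Nat.sub_ne_zero_of_lt hlt), if_neg hlt.ne, mul_zero]

/-- The partial fraction expansion of the rational function of `mgfDelta`, evaluated at the
imaginary point `it`. -/
theorem charFun_partialFractions (hD : ∀ k, D k ≠ 0) (hinj : Function.Injective fun k => D k ^ 2)
    (hl : (l : ℕ) < Nr) (t : ℝ) :
    ((1 - t * Complex.I * (D l ^ 2 : ℝ)) ^ (Nr - (l : ℕ)))⁻¹ *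
        ∏ j ∈ Finset.Ioi l, (1 - t * Complex.I * (D j ^ 2 : ℝ))⁻¹ =
      ∑ k ∈ Finset.Icc 1 (Nr - (l : ℕ)),
        (headCoeff Nr D l k : ℂ) * ((1 - t * Complex.I * (D l ^ 2 : ℝ)) ^ k)⁻¹ +
      ∑ j ∈ Finset.Ioi l, (tailCoeff Nr D l j : ℂ) * (1 - t * Complex.I * (D j ^ 2 : ℝ))⁻¹ := by
  set n := Nr - (l : ℕ) with hn
  have hn1 : 1 ≤ n := by omega
  rcases (Finset.Ioi l).eq_empty_or_nonempty with hJ | hJ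
  · simp only [hJ, Finset.prod_empty, Finset.sum_empty, mul_one, add_zero]
    rw [Finset.sum_eq_single n]
    · rw [headCoeff_of_Ioi_eq_empty hJ le_rfl]
      simp
    · intro k hk hkn
      rw [headCoeff_of_Ioi_eq_empty hJ (Finset.mem_Icc.1 hk).2, if_neg hkn]
      simp
    · intro h
      exact (h (Finset.mem_Icc.2 ⟨hn1, le_rfl⟩)).elim
  have hα : ∀ k, ((D k ^ 2 : ℝ) : ℂ) ≠ 0 := fun k => by exact_mod_cast pow_ne_zero 2 (hD k)
  have hz : ∀ k, (1 - t * Complex.I * (D k ^ 2 : ℝ) : ℂ) ≠ 0 := fun k =>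
    one_sub_mul_I_mul_ne_zero t _
  have hinjC : Function.Injective fun k => ((D k ^ 2 : ℝ) : ℂ) :=
    Complex.ofReal_injective.comp hinj
  rw [prod_inv_one_sub_mul_eq_sum (β := fun k => ((D k ^ 2 : ℝ) : ℂ)) hJ (fun j _ => hα j)
    hinjC.injOn (fun j _ => hz j), Finset.mul_sum]
  have hterm : ∀ j ∈ Finset.Ioi l, ((1 - t * Complex.I * (D l ^ 2 : ℝ)) ^ n)⁻¹ *
      ((∏ i ∈ (Finset.Ioi l).erase j, (1 - ((D j ^ 2 : ℝ) : ℂ)⁻¹ * (D i ^ 2 : ℝ))⁻¹) *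
        (1 - t * Complex.I * (D j ^ 2 : ℝ))⁻¹) =
      ∑ m ∈ Finset.range n, (((∏ i ∈ (Finset.Ioi l).erase j, (1 - (D j ^ 2)⁻¹ * D i ^ 2)⁻¹) *
        ((1 - (D l ^ 2)⁻¹ * D j ^ 2)⁻¹ * ((1 - (D j ^ 2)⁻¹ * D l ^ 2)⁻¹) ^ m) : ℝ) : ℂ) *
          ((1 - t * Complex.I * (D l ^ 2 : ℝ)) ^ (n - m))⁻¹ +
        (tailCoeff Nr D l j : ℂ) * (1 - t * Complex.I * (D j ^ 2 : ℝ))⁻¹ := by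
    intro j hj
    have hlj : ((D l ^ 2 : ℝ) : ℂ) ≠ ((D j ^ 2 : ℝ) : ℂ) := fun h =>
      (Finset.mem_Ioi.1 hj).ne (hinjC h)
    rw [mul_left_comm, inv_pow_mul_inv_eq_sum (hα l) (hα j) hlj (hz l) (hz j) n, mul_add,
      Finset.mul_sum, tailCoeff, tailFun]
    congr 1
    · refine Finset.sum_congr rfl fun m _ => ?_
      push_cast
      ring
    · push_cast
      rw [← hn]
      ring
  rw [Finset.sum_congr rfl hterm, Finset.sum_add_distrib, Finset.sum_comm]
  congr 1
  simp_rw [← Finset.sum_mul]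
  refine Finset.sum_bij' (fun m _ => n - m) (fun k _ => n - k) ?_ ?_ ?_ ?_ ?_
  · intro m hm
    simp only [Finset.mem_range, Finset.mem_Icc] at hm ⊢
    omega
  · intro k hk
    simp only [Finset.mem_range, Finset.mem_Icc] at hk ⊢
    omega
  · intro m hm
    simp only [Finset.mem_range] at hm
    omega
  · intro k hk
    simp only [Finset.mem_Icc] at hk
    omega
  · intro m hm
    rw [headCoeff_eq_sum hD hinj hJ (Finset.mem_range.1 hm).le, Complex.ofReal_sum]

end Coefficients

/-! ### Distribution of the row powers -/

/-- Extension by zero of a family of squared singular values to weights indexed by `ℕ`. -/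
noncomputable def sqWeight {Nt : ℕ} (D : Fin Nt → ℝ) (k : ℕ) : ℝ :=
  if h : k < Nt then D ⟨k, h⟩ ^ 2 else 0

theorem sqWeight_val {Nt : ℕ} (D : Fin Nt → ℝ) (k : Fin Nt) : sqWeight D k = D k ^ 2 := by
  simp [sqWeight]

theorem sqWeight_nonneg {Nt : ℕ} (D : Fin Nt → ℝ) (k : ℕ) : 0 ≤ sqWeight D k := by
  unfold sqWeight
  split_ifs
  · positivity
  · exact le_rfl

theorem prod_fin_shift_eq_prod_Ioi {M : Type*} [CommMonoid M] {n : ℕ} (l : Fin n) (f : ℕ → M) :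
    ∏ j : Fin (n - 1 - l), f (l + (j + 1)) = ∏ j ∈ Finset.Ioi l, f j := by
  refine Finset.prod_bij (fun j _ => ⟨l + (j + 1), by omega⟩) ?_ ?_ ?_ ?_
  · intro j _
    rw [Finset.mem_Ioi, Fin.lt_def]
    simp
  · intro i _ j _ h
    rw [Fin.mk.injEq] at h
    ext
    omega
  · intro k hk
    rw [Finset.mem_Ioi, Fin.lt_def] at hk
    refine ⟨⟨k - l - 1, by omega⟩, Finset.mem_univ _, ?_⟩
    ext
    simp only
    omega
  · intro j _
    rfl

/-- The power of row `l` has the characteristic function `t ↦ Ψ(it)`, where `Ψ` is the rational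
function of `mgfDelta`, when `m = Nr - l`. -/
theorem charFun_rowLaw_sqWeight {Nt : ℕ} (D : Fin Nt → ℝ) (l : Fin Nt) (m : ℕ) (t : ℝ) :
    charFun (rowLaw m (Nt - 1 - l) fun j => sqWeight D (l + j)) t =
      ((1 - t * Complex.I * (D l ^ 2 : ℝ)) ^ m)⁻¹ *
        ∏ j ∈ Finset.Ioi l, (1 - t * Complex.I * (D j ^ 2 : ℝ))⁻¹ := by
  rw [charFun_rowLaw,
    prod_fin_shift_eq_prod_Ioi l fun k => (1 - t * Complex.I * (sqWeight D k : ℂ))⁻¹]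
  simp only [add_zero, sqWeight_val]

/-- With equal singular values, the power of a row has a Gamma law. -/
theorem rowProb_eq_gammaInc {Nt Nr : ℕ} {D : Fin Nt → ℝ} (hD : ∀ k, D k ^ 2 = 1) (l : Fin Nt)
    (hl : (l : ℕ) < Nr) {x : ℝ} (hx : 0 ≤ x) :
    (rowProb (Nr - l) (Nt - 1 - l) (fun j => sqWeight D (l + j)) x).toReal =
      gammaInc x (Nr + Nt - 2 * ((l : ℕ) + 1) + 1) := by
  rw [rowProb_toReal, measureReal_eq_sum_of_charFun {()} _
    (fun _ => erlangLaw (Nr + Nt - 2 * ((l : ℕ) + 1) + 1) 1) (fun _ => 1)]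
  · rw [Finset.sum_singleton, one_mul, erlangLaw_real_Iio one_pos hx, div_one]
  · intro t
    rw [charFun_rowLaw_sqWeight, Finset.sum_singleton, charFun_erlangLaw (by omega)]
    simp only [hD, Finset.prod_const, Fin.card_Ioi, inv_pow, Complex.ofReal_one, one_mul]
    rw [← mul_inv, ← pow_add]
    congr 2
    omega

/-- With distinct singular values, the power of a row has the law given by the partial fractions of
its characteristic function. -/
theorem rowProb_eq_corrFactor {Nt Nr : ℕ} {D : Fin Nt → ℝ} (hD : ∀ k, D k ≠ 0)
    (hinj : Function.Injective fun k => D k ^ 2) (l : Fin Nt) (hl : (l : ℕ) < Nr) {x : ℝ}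
    (hx : 0 ≤ x) :
    (rowProb (Nr - l) (Nt - 1 - l) (fun j => sqWeight D (l + j)) x).toReal =
      corrFactor Nr D l x := by
  have hpos : ∀ k, 0 < D k ^ 2 := fun k => sq_pos_of_ne_zero (hD k)
  have hfin : ∀ i, IsFiniteMeasure (Sum.elim (fun k => erlangLaw k (D l ^ 2))
      (fun j => erlangLaw 1 (D j ^ 2)) i : Measure ℝ) := by
    rintro (k | j)
    · exact inferInstanceAs (IsFiniteMeasure (erlangLaw k _))
    · exact inferInstanceAs (IsFiniteMeasure (erlangLaw 1 _))
  rw [rowProb_toReal, measureReal_eq_sum_of_charFun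
    ((Finset.Icc 1 (Nr - (l : ℕ))).disjSum (Finset.Ioi l)) _
    (Sum.elim (fun k => erlangLaw k (D l ^ 2)) fun j => erlangLaw 1 (D j ^ 2))
    (Sum.elim (headCoeff Nr D l) (tailCoeff Nr D l))]
  · rw [Finset.sum_disjSum]
    simp only [Sum.elim_inl, Sum.elim_inr, erlangLaw_real_Iio (hpos _) hx]
    rfl
  · intro t
    rw [charFun_rowLaw_sqWeight, charFun_partialFractions hD hinj hl, Finset.sum_disjSum]
    congr 1
    · refine Finset.sum_congr rfl fun k hk => ?_
      rw [Sum.elim_inl, Sum.elim_inl, charFun_erlangLaw (Finset.mem_Icc.1 hk).1]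
    · refine Finset.sum_congr rfl fun j _ => ?_
      rw [Sum.elim_inr, Sum.elim_inr, charFun_erlangLaw le_rfl, pow_one]

/-! ### Reduction of the correlated channel to independent columns -/

/-- Arranging a matrix of independent entries as one family indexed by pairs. -/
theorem measurePreserving_uncurry {ι κ τ : Type*} [Fintype ι] [Fintype κ] [Fintype τ]
    (e : τ ≃ ι × κ) :
    MeasurePreserving (fun (H : ι → κ → ℂ) (p : τ) => H (e p).1 (e p).2)
      (Measure.pi fun _ => Measure.pi fun _ => complexGaussian)
      (Measure.pi fun _ => complexGaussian) := by
  have hm : Measurable (fun (H : ι → κ → ℂ) (p : τ) => H (e p).1 (e p).2) := by fun_prop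
  refine ⟨hm, (Measure.pi_eq fun s hs => ?_).symm⟩
  have hpre : (fun (H : ι → κ → ℂ) (p : τ) => H (e p).1 (e p).2) ⁻¹' Set.univ.pi s =
      Set.univ.pi fun i => Set.univ.pi fun k => s (e.symm (i, k)) := by
    ext H
    simp only [Set.mem_preimage, Set.mem_univ_pi]
    refine ⟨fun h i k => by simpa using h (e.symm (i, k)),
      fun h p => by simpa using h (e p).1 (e p).2⟩
  rw [Measure.map_apply hm (MeasurableSet.univ_pi hs), hpre, Measure.pi_pi]
  simp_rw [Measure.pi_pi]
  rw [← Fintype.prod_prod_type' (f := fun i k => complexGaussian (s (e.symm (i, k)))),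
    ← e.symm.prod_comp]

theorem measurePreserving_transpose (n m : ℕ) :
    MeasurePreserving (fun (H : Fin m → Fin n → ℂ) j i => H i j)
      (columnsLaw m n) (columnsLaw n m) := by
  have hA : MeasurePreserving (fun (H : Fin m → Fin n → ℂ) (p : Fin m × Fin n) => H p.1 p.2)
      (columnsLaw m n) (Measure.pi fun _ => complexGaussian) :=
    measurePreserving_uncurry (Equiv.refl _)
  have hB := measurePreserving_uncurry (Equiv.prodComm (Fin m) (Fin n))
  refine ⟨by fun_prop, ?_⟩
  have hg : Measurable fun (V : Fin m × Fin n → ℂ) (j : Fin n) (i : Fin m) => V (i, j) := by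
    fun_prop
  calc _ = (columnsLaw m n).map ((fun (V : Fin m × Fin n → ℂ) (j : Fin n) (i : Fin m) => V (i, j)) ∘
        fun (H : Fin m → Fin n → ℂ) p => H p.1 p.2) := rfl
    _ = (Measure.pi fun _ => complexGaussian).map
        fun (V : Fin m × Fin n → ℂ) (j : Fin n) (i : Fin m) => V (i, j) := by
      rw [← Measure.map_map hg hA.measurable, hA.map_eq]
    _ = columnsLaw n m := by
      rw [← hB.map_eq, Measure.map_map hg hB.measurable]
      exact Measure.map_id

theorem transpose_mem_unitaryGroup {n : ℕ} {U : Matrix (Fin n) (Fin n) ℂ}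
    (hU : U ∈ Matrix.unitaryGroup (Fin n) ℂ) : Uᵀ ∈ Matrix.unitaryGroup (Fin n) ℂ := by
  rw [Matrix.mem_unitaryGroup_iff]
  have h : star Uᵀ = (star U)ᵀ := rfl
  rw [h, ← Matrix.transpose_mul, Matrix.mem_unitaryGroup_iff'.1 hU, Matrix.transpose_one]

/-- The columns of a spatially uncorrelated Rayleigh channel matrix multiplied on the right by a
unitary matrix are again independent with independent Gaussian entries. -/
theorem IsRayleigh.map_columns_mul {Ω : Type*} [MeasurableSpace Ω] {P : Measure Ω}
    [IsProbabilityMeasure P] {Nt Nr : ℕ} {Hw : Ω → Matrix (Fin Nr) (Fin Nt) ℂ}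
    (hHw : IsRayleigh P Hw) {U : Matrix (Fin Nt) (Fin Nt) ℂ}
    (hU : U ∈ Matrix.unitaryGroup (Fin Nt) ℂ) :
    AEMeasurable (fun ω (j : Fin Nt) (i : Fin Nr) => (Hw ω * U) i j) P ∧
    P.map (fun ω (j : Fin Nt) (i : Fin Nr) => (Hw ω * U) i j) = columnsLaw Nt Nr := by
  obtain ⟨hind, hlaw⟩ := hHw
  have hVm : AEMeasurable (fun ω (p : Fin Nr × Fin Nt) => Hw ω p.1 p.2) P :=
    aemeasurable_pi_lambda _ fun p => (hlaw p.1 p.2).aemeasurable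
  have hV : P.map (fun ω (p : Fin Nr × Fin Nt) => Hw ω p.1 p.2) =
      Measure.pi fun _ => complexGaussian := by
    refine (iIndepFun.map_fun_eq_pi_map (f := fun (p : Fin Nr × Fin Nt) ω => Hw ω p.1 p.2)
      (fun p => (hlaw p.1 p.2).aemeasurable) hind).trans ?_
    congr 1
    funext p
    exact (hlaw p.1 p.2).map_eq
  have hA := measurePreserving_uncurry (Equiv.refl (Fin Nr × Fin Nt))
  have hT := (measurePreserving_transpose Nt Nr).comp
    (measurePreserving_columns_mulVec (n := Nr) (transpose_mem_unitaryGroup hU))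
  have hg : Measurable fun (V : Fin Nr × Fin Nt → ℂ) (j : Fin Nt) (i : Fin Nr) =>
      (Uᵀ *ᵥ fun k => V (i, k)) j := by
    simp only [Matrix.mulVec, dotProduct]
    fun_prop
  have hcomp : (fun ω (j : Fin Nt) (i : Fin Nr) => (Hw ω * U) i j) =
      (fun (V : Fin Nr × Fin Nt → ℂ) (j : Fin Nt) (i : Fin Nr) => (Uᵀ *ᵥ fun k => V (i, k)) j) ∘
        fun ω (p : Fin Nr × Fin Nt) => Hw ω p.1 p.2 := by
    funext ω j i
    simp [Matrix.mul_apply, Matrix.mulVec, dotProduct, mul_comm]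
  rw [hcomp]
  refine ⟨hg.comp_aemeasurable hVm, ?_⟩
  rw [← AEMeasurable.map_map_of_aemeasurable hg.aemeasurable hVm, hV, ← hA.map_eq,
    Measure.map_map hg hA.measurable]
  exact hT.map_eq

/-! ### The outage probability -/

/-- The unitary factor `V` of the singular value decomposition cancels in `H Hᴴ`, and the factor `U`
is absorbed into the columns. -/
theorem one_add_smul_mul_conjTranspose_eq_columnGram {Nt Nr : ℕ} (c : ℝ)
    (Hw : Matrix (Fin Nr) (Fin Nt) ℂ) {S U V : Matrix (Fin Nt) (Fin Nt) ℂ} {D : Fin Nt → ℝ}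
    (hV : V ∈ Matrix.unitaryGroup (Fin Nt) ℂ)
    (hS : S = U * Matrix.diagonal (fun k => (D k : ℂ)) * Vᴴ) :
    1 + (c : ℂ) • ((Hw * S) * (Hw * S)ᴴ) =
      columnGram c (sqWeight D) fun (j : Fin Nt) (i : Fin Nr) => (Hw * U) i j := by
  have hV' : Vᴴ * V = 1 := Matrix.mem_unitaryGroup_iff'.1 hV
  have h1 : (Hw * S) * (Hw * S)ᴴ =
      (Hw * U) * Matrix.diagonal (fun k => ((D k ^ 2 : ℝ) : ℂ)) * (Hw * U)ᴴ := by
    have h2 : Hw * S = (Hw * U) * Matrix.diagonal (fun k => (D k : ℂ)) * Vᴴ := by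
      rw [hS]
      simp only [Matrix.mul_assoc]
    have h3 : ∀ A B : Matrix (Fin Nr) (Fin Nt) ℂ, A * Vᴴ * (V * Bᴴ) = A * Bᴴ := by
      intro A B
      rw [Matrix.mul_assoc, ← Matrix.mul_assoc Vᴴ, hV', Matrix.one_mul]
    rw [h2, Matrix.conjTranspose_mul _ Vᴴ, Matrix.conjTranspose_conjTranspose, h3,
      Matrix.conjTranspose_mul, Matrix.diagonal_conjTranspose, ← Matrix.mul_assoc,
      Matrix.mul_assoc (Hw * U) (Matrix.diagonal _) (Matrix.diagonal _),
      Matrix.diagonal_mul_diagonal]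
    congr 3
    funext k
    simp [sq]
  rw [h1, columnGram]
  congr 1
  ext i k
  rw [Matrix.smul_apply, Matrix.mul_apply, Matrix.sum_apply, smul_eq_mul, Finset.mul_sum]
  refine Finset.sum_congr rfl fun j _ => ?_
  rw [Matrix.mul_diagonal, Matrix.smul_apply, Matrix.vecMulVec_apply, sqWeight_val,
    Matrix.conjTranspose_apply, smul_eq_mul, Pi.star_apply]
  push_cast
  ring

theorem mutualInfo_lt_rate_iff {Nt Nr : ℕ} {η r : ℝ} (hη : 0 < η) (H : Matrix (Fin Nr) (Fin Nt) ℂ)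
    (hdet : 0 < (1 + ((η / Nt : ℝ) : ℂ) • (H * Hᴴ)).det.re) :
    mutualInfo η H < rate Nr r η ↔
      (1 + ((η / Nt : ℝ) : ℂ) • (H * Hᴴ)).det.re < (1 + arrayGain Nr * η) ^ r := by
  have hg : 0 < 1 + arrayGain Nr * η := by unfold arrayGain; positivity
  rw [mutualInfo, rate, ← Real.logb_rpow_eq_mul_logb_of_pos hg,
    Real.logb_lt_logb_iff one_lt_two hdet (Real.rpow_pos_of_pos hg r)]

/-- The outage probability is at least the probability that every row of the triangularized
channel stays below its threshold. -/
theorem prod_rowProb_le_outageProb {Ω : Type*} [MeasurableSpace Ω] (P : Measure Ω)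
    [IsProbabilityMeasure P] {Nt Nr : ℕ} (hNt : 1 ≤ Nt) (hNr : 1 ≤ Nr)
    {Hw : Ω → Matrix (Fin Nr) (Fin Nt) ℂ} (hHw : IsRayleigh P Hw)
    {S : Matrix (Fin Nt) (Fin Nt) ℂ} {D : Fin Nt → ℝ} (hD : IsSingularValues S D)
    {η r : ℝ} (hη : 0 < η) {b : Fin (min Nt Nr) → ℝ} (hr : r = ∑ l, b l) :
    ∏ l : Fin (min Nt Nr), (rowProb (Nr - l) (Nt - 1 - l) (fun j => sqWeight D (l + j))
        (xi Nr Nt η (b l))).toReal ≤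
      outageProb P (fun ω => Hw ω * S) r η := by
  obtain ⟨-, U, hU, V, hV, hS⟩ := hD
  obtain ⟨hm, hmap⟩ := hHw.map_columns_mul hU
  have hNt0 : (0 : ℝ) < Nt := by exact_mod_cast hNt
  have hc : 0 < η / Nt := by positivity
  have hg : 0 < 1 + arrayGain Nr * η := by unfold arrayGain; positivity
  set x : ℕ → ℝ := fun l => if h : l < min Nt Nr then xi Nr Nt η (b ⟨l, h⟩) else 0 with hx
  have hxl : ∀ l : Fin (min Nt Nr), x l = xi Nr Nt η (b l) := fun l => by
    simp only [hx]
    rw [dif_pos l.2]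
  have hprod : ∏ l ∈ Finset.range (min Nt Nr), (1 + η / Nt * x l) =
      (1 + arrayGain Nr * η) ^ r := by
    rw [Finset.prod_range, hr, Real.rpow_sum_of_pos hg]
    refine Finset.prod_congr rfl fun l _ => ?_
    rw [hxl, xi]
    field_simp
    ring
  have hset : {ω | mutualInfo η (Hw ω * S) < rate Nr r η} =
      (fun ω (j : Fin Nt) (i : Fin Nr) => (Hw ω * U) i j) ⁻¹'
        {H | (columnGram (η / Nt) (sqWeight D) H).det.re <
          ∏ l ∈ Finset.range (min Nt Nr), (1 + η / Nt * x l)} := by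
    ext ω
    have hgram := one_add_smul_mul_conjTranspose_eq_columnGram (η / Nt) (Hw ω) hV hS
    have hdet := (Complex.lt_def.1 (posDef_columnGram hc.le (sqWeight_nonneg D)
      fun (j : Fin Nt) (i : Fin Nr) => (Hw ω * U) i j).det_pos).1
    rw [Set.mem_ofPred_eq, mutualInfo_lt_rate_iff hη _ (by rw [hgram]; exact hdet), hgram, hprod]
    rfl
  have hmeas : MeasurableSet {H : Fin Nt → Fin Nr → ℂ |
      (columnGram (η / Nt) (sqWeight D) H).det.re <
        ∏ l ∈ Finset.range (min Nt Nr), (1 + η / Nt * x l)} :=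
    (isOpen_lt (continuous_det_columnGram _ _ _ _) continuous_const).measurableSet
  have hle := ENNReal.toReal_mono (measure_ne_top _ _)
    (prod_rowProb_le_lt hc hNt hNr (sqWeight_nonneg D) x)
  rw [ENNReal.toReal_prod, Finset.prod_range] at hle
  simp only [hxl] at hle
  rwa [outageProb, Measure.real, hset, ← Measure.map_apply_of_aemeasurable hm hmeas, hmap]

theorem IsSingularValues.ne_zero {n : ℕ} {S R : Matrix (Fin n) (Fin n) ℂ} {D : Fin n → ℝ}
    (hD : IsSingularValues S D) (hR : R.PosDef) (hS : S * Sᴴ = R) (k : Fin n) : D k ≠ 0 := by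
  intro h0
  obtain ⟨-, U, -, V, -, h⟩ := hD
  have hdet : S.det = 0 := by
    rw [h, Matrix.det_mul, Matrix.det_mul, Matrix.det_diagonal,
      Finset.prod_eq_zero (Finset.mem_univ k) (by simp [h0]), mul_zero, zero_mul]
  have := hR.det_pos.ne'
  rw [← hS, Matrix.det_mul, hdet, zero_mul] at this
  exact this rfl

theorem xi_nonneg {Nr Nt : ℕ} {η b : ℝ} (hη : 0 < η) (hb : 0 < b) : 0 ≤ xi Nr Nt η b := by
  have h : (1 : ℝ) ≤ (1 + arrayGain Nr * η) ^ b := by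
    refine Real.one_le_rpow ?_ hb.le
    have : 0 ≤ arrayGain Nr * η := by unfold arrayGain; positivity
    linarith
  exact mul_nonneg (by positivity) (sub_nonneg.2 h)

end MimoOutage

theorem theorem1 {Ω : Type*} [MeasurableSpace Ω] (P : Measure Ω) [IsProbabilityMeasure P]
    (Nt Nr : ℕ) (hNt : 1 ≤ Nt) (hNr : 1 ≤ Nr)
    (Hw : Ω → Matrix (Fin Nr) (Fin Nt) ℂ) (hHw : MimoOutage.IsRayleigh P Hw)
    -- transmit correlation matrix, a square root of it, and the singular values of that root
    (Rt S : Matrix (Fin Nt) (Fin Nt) ℂ) (hRt : Rt.PosDef) (hS : S * Sᴴ = Rt)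
    (D : Fin Nt → ℝ) (hD : MimoOutage.IsSingularValues S D)
    (η r : ℝ) (hη : 0 < η)
    (b : Fin (min Nt Nr) → ℝ) (hb : ∀ l, 0 < b l) (hr : r = ∑ l, b l) :
    -- uncorrelated fading
    ((∀ k, D k ^ 2 = 1) →
      ∏ l : Fin (min Nt Nr),
          MimoOutage.gammaInc (MimoOutage.xi Nr Nt η (b l)) (Nr + Nt - 2 * ((l : ℕ) + 1) + 1)
        ≤ MimoOutage.outageProb P (fun ω => Hw ω * S) r η) ∧
    -- correlated fading with distinct eigenvalues
    (Function.Injective (fun k => D k ^ 2) →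
      ∏ l : Fin (min Nt Nr),
          MimoOutage.corrFactor Nr D (Fin.castLE (min_le_left Nt Nr) l)
            (MimoOutage.xi Nr Nt η (b l))
        ≤ MimoOutage.outageProb P (fun ω => Hw ω * S) r η) := by
  have hle := MimoOutage.prod_rowProb_le_outageProb P hNt hNr hHw hD hη hr
  have hlt : ∀ l : Fin (min Nt Nr), (l : ℕ) < Nr := fun l => l.2.trans_le (min_le_right _ _)
  refine ⟨fun h1 => ?_, fun hinj => ?_⟩
  · exact (Finset.prod_congr rfl fun l _ => (MimoOutage.rowProb_eq_gammaInc h1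
      (Fin.castLE (min_le_left Nt Nr) l) (hlt l)
      (MimoOutage.xi_nonneg hη (hb l))).symm).le.trans hle
  · exact (Finset.prod_congr rfl fun l _ => (MimoOutage.rowProb_eq_corrFactor
      (fun k => hD.ne_zero hRt hS k) hinj (Fin.castLE (min_le_left Nt Nr) l) (hlt l)
      (MimoOutage.xi_nonneg hη (hb l))).symm).le.trans hle
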